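/- Let $T$ be a locally finite tree with root $v_0$ and without leaves, that is, every vertex has at least one child (a neighbour farther from $v_0$). Let $\partial T$ be the set of infinite paths $\xi=(\xi_0,\xi_1,\dots)$ with $\xi_0=v_0$ and $\xi_{n+1}$ a child of $\xi_n$ for all $n$, with the topology of the visual metric $d(\xi,\xi')=2^{-N(\xi,\xi')}$ for $\xi\ne\xi'$ (and $d(\xi,\xi)=0$), where $N(\xi,\xi')$ is the smallest $n$ such that $\xi_n\neq\xi'_n$. For a vertex $v$ let $\partial T_v$ be the clopen ball of all $\xi\in\partial T$ that pass through $v$. Fix for every vertex $v$ a total order $<_v$ on the set of children of $v$, and order $\partial T$ by declaring $\xi<\xi'$ if $\xi\ne\xi'$ and $\xi_n<_{\xi_{n-1}}\xi'_n$ for $n=N(\xi,\xi')$. Let $V_T$ be the group of all homeomorphisms $g$ of $\partial T$ for which there are a finite partition of $\partial T$ into clopen balls $D_1,\dots,D_n$, each of the form $\partial T_v$, and positive numbers $\lambda_1,\dots,\lambda_n$ such that, for every $j$, $d(g(y),g(z))=\lambda_j\,d(y,z)$ for all $y,z\in D_j$ and $g|_{D_j}$ is order-preserving. Let $H$ be a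 finitely generated subgroup of $V_T$. Then the action of $H$ on $\partial T$ has a finite orbit, or it admits a ping-pong pair, that is, there exist $g,h\in H$ and pairwise disjoint open sets $U_1,U_2,V_1,V_2\subseteq\partial T$ such that $$g(\partial T\setminus U_1)\subseteq V_1\quad\text{and}\quad h(\partial T\setminus U_2)\subseteq V_2 .$$ -/

import Mathlib

/-- A locally finite rooted tree without leaves (every vertex has a child, that is, a neighbour
farther away from the root). -/
structure LFRootedTree (V : Type*) where
  graph : SimpleGraph V
  isTree : graph.IsTree
  locallyFinite : ∀ v, (graph.neighborSet v).Finite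
  root : V
  noLeaves : ∀ v, ∃ w, graph.Adj v w ∧ graph.dist root w = graph.dist root v + 1

namespace LFRootedTree

variable {V : Type*} (T : LFRootedTree V)

/-- `w` is a child of `v`: the edge from `v` to `w` is directed away from the root. -/
def IsChild (v w : V) : Prop :=
  T.graph.Adj v w ∧ T.graph.dist T.root w = T.graph.dist T.root v + 1

/-- The boundary `∂T`: one-sided infinite directed paths starting at the root. -/
@[ext] structure Boundary where
  vertex : ℕ → V
  vertex_zero : vertex 0 = T.root
  isChild : ∀ n, T.IsChild (vertex n) (vertex (n + 1))

variable {T}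

instance : CoeFun T.Boundary (fun _ => ℕ → V) := ⟨Boundary.vertex⟩

theorem Boundary.coe_injective :
    Function.Injective (fun ξ : T.Boundary => ξ.vertex) := fun _ _ h => Boundary.ext h

/-- The visual metric: `d(ξ, η) = 2 ^ (-N)` with `N` the smallest `n` such that `ξ n ≠ η n`,
and `d(ξ, ξ) = 0`. The topology of `∂T` is the one of this metric. -/
noncomputable instance : MetricSpace T.Boundary where
  dist ξ η := open Classical in
    if ξ = η then 0 else (1 / 2 : ℝ) ^ PiNat.firstDiff ξ.vertex η.vertex
  dist_self ξ := by simp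
  dist_comm ξ η := by
    rcases eq_or_ne ξ η with rfl | h
    · rfl
    · simp only [h, h.symm, if_false, PiNat.firstDiff_comm ξ.vertex]
  dist_triangle ξ η ζ := by
    rcases eq_or_ne ξ ζ with rfl | h
    · simp only [if_true]; split_ifs <;> positivity
    rcases eq_or_ne ξ η with rfl | h₁
    · simp
    rcases eq_or_ne η ζ with rfl | h₂
    · simp
    have hv : ∀ {a b : T.Boundary}, a ≠ b → a.vertex ≠ b.vertex :=
      fun hab e => hab (Boundary.coe_injective e)
    have := PiNat.dist_triangle ξ.vertex η.vertex ζ.vertex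
    rw [PiNat.dist_eq_of_ne (hv h), PiNat.dist_eq_of_ne (hv h₁), PiNat.dist_eq_of_ne (hv h₂)] at this
    simpa only [h, h₁, h₂, if_false] using this
  eq_of_dist_eq_zero {ξ η} h := by
    by_contra hne
    simp [hne] at h

variable (T) in
/-- The clopen ball `∂T_v` of all ends passing through the vertex `v`. -/
def ball (v : V) : Set T.Boundary := {ξ | ∃ n, ξ n = v}

/-- `P` is an admissible partition for `g`: a finite partition of `∂T` into clopen balls such that
`g` multiplies the visual metric by a positive constant on each of them. -/
def IsAdmissible (g : T.Boundary ≃ₜ T.Boundary) (P : Set (Set T.Boundary)) : Prop :=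
  P.Finite ∧ Setoid.IsPartition P ∧ (∀ D ∈ P, ∃ v, D = T.ball v) ∧
    ∀ D ∈ P, ∃ c : ℝ, 0 < c ∧ ∀ y ∈ D, ∀ z ∈ D, dist (g y) (g z) = c * dist y z

/-- An almost automorphism of `T`. -/
def IsAlmostAutomorphism (g : T.Boundary ≃ₜ T.Boundary) : Prop := ∃ P, IsAdmissible g P

variable (T) in
/-- A family of (strict) total orders, one on the set of children of each vertex. -/
structure ChildOrders where
  /-- `lt v a b` is `a <_v b`; only its values on children `a`, `b` of `v` matter. -/
  lt : V → V → V → Prop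
  isStrictTotalOrder : ∀ v,
    IsStrictTotalOrder {w // T.IsChild v w} (fun a b => lt v a.1 b.1)

/-- The induced order on `∂T`: `ξ` and `η` agree exactly up to some index `n`, and
`ξ (n + 1) <_{ξ n} η (n + 1)`. -/
def ChildOrders.boundaryLT (o : T.ChildOrders) (ξ η : T.Boundary) : Prop :=
  ∃ n, (∀ m ≤ n, ξ m = η m) ∧ o.lt (ξ n) (ξ (n + 1)) (η (n + 1))

/-- A Higman-Thompson element: an almost automorphism with an admissible partition on each piece of
which it is order-preserving. -/
def IsHigmanThompson (o : T.ChildOrders) (g : T.Boundary ≃ₜ T.Boundary) : Prop :=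
  ∃ P, IsAdmissible g P ∧
    ∀ D ∈ P, ∀ ξ ∈ D, ∀ η ∈ D, o.boundaryLT ξ η → o.boundaryLT (g ξ) (g η)

/-! ### Higman-Thompson elements form a group -/

theorem IsHigmanThompson.isAlmostAutomorphism {o : T.ChildOrders} {g : T.Boundary ≃ₜ T.Boundary}
    (h : IsHigmanThompson o g) : IsAlmostAutomorphism g :=
  h.imp fun _ hP => hP.1

theorem IsChild.parent_unique {u v w : V} (hu : T.IsChild u w) (hv : T.IsChild v w) : u = v := by
  obtain ⟨p, hp⟩ := T.isTree.connected.exists_walk_length_eq_dist T.root u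
  obtain ⟨q, hq⟩ := T.isTree.connected.exists_walk_length_eq_dist T.root v
  have hp' : (p.concat hu.1).IsPath := by
    apply SimpleGraph.Walk.isPath_of_length_eq_dist
    rw [SimpleGraph.Walk.length_concat, hp, hu.2]
  have hq' : (q.concat hv.1).IsPath := by
    apply SimpleGraph.Walk.isPath_of_length_eq_dist
    rw [SimpleGraph.Walk.length_concat, hq, hv.2]
  have := (T.isTree.existsUnique_path T.root w).unique hp' hq'
  have := congrArg SimpleGraph.Walk.penultimate this
  simpa using this

theorem Boundary.dist_root (ξ : T.Boundary) (n : ℕ) : T.graph.dist T.root (ξ n) = n := by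
  induction n with
  | zero => rw [ξ.vertex_zero, SimpleGraph.dist_self]
  | succ n ih => rw [(ξ.isChild n).2, ih]

theorem Boundary.eq_of_le {ξ η : T.Boundary} {n : ℕ} (h : ξ n = η n) : ∀ m ≤ n, ξ m = η m := by
  induction n with
  | zero => intro m hm; obtain rfl : m = 0 := by omega
            exact h
  | succ n ih =>
    have h' : ξ n = η n := (ξ.isChild n).parent_unique (h ▸ η.isChild n)
    intro m hm
    rcases Nat.lt_or_ge m (n + 1) with h1 | h1
    · exact ih h' m (by omega)
    · obtain rfl : m = n + 1 := by omega
      exact h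

theorem mem_ball_vertex {ξ η : T.Boundary} {n : ℕ} : η ∈ T.ball (ξ n) ↔ η n = ξ n := by
  refine ⟨fun ⟨m, hm⟩ => ?_, fun h => ⟨n, h⟩⟩
  have := η.dist_root m
  rw [hm, ξ.dist_root n] at this
  rw [← this] at hm
  exact hm

theorem Boundary.dist_of_ne {ξ η : T.Boundary} (h : ξ ≠ η) :
    dist ξ η = (1 / 2 : ℝ) ^ PiNat.firstDiff ξ.vertex η.vertex := if_neg h

theorem exists_ball_subset {ξ : T.Boundary} {U : Set T.Boundary} (hU : U ∈ nhds ξ) :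
    ∃ n, T.ball (ξ n) ⊆ U := by
  obtain ⟨ε, hε, h⟩ := Metric.mem_nhds_iff.1 hU
  obtain ⟨n, hn⟩ := exists_pow_lt_of_lt_one hε (by norm_num : (1 / 2 : ℝ) < 1)
  refine ⟨n, fun η hη => h ?_⟩
  rw [mem_ball_vertex] at hη
  rw [Metric.mem_ball]
  by_cases hne : η = ξ
  · simpa [hne] using hε
  rw [Boundary.dist_of_ne hne]
  refine lt_of_le_of_lt (pow_le_pow_of_le_one (by norm_num) (by norm_num) ?_) hn
  by_contra hlt
  have hne' : η.vertex ≠ ξ.vertex := fun e => hne (Boundary.coe_injective e)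
  exact PiNat.apply_firstDiff_ne hne' (Boundary.eq_of_le hη _ (by omega))

theorem ball_mem_nhds (ξ : T.Boundary) (n : ℕ) : T.ball (ξ n) ∈ nhds ξ := by
  refine Metric.mem_nhds_iff.2 ⟨(1 / 2 : ℝ) ^ n, by positivity, fun η hη => ?_⟩
  rw [mem_ball_vertex]
  by_cases hne : η = ξ
  · rw [hne]
  rw [Metric.mem_ball, Boundary.dist_of_ne hne] at hη
  exact PiNat.apply_eq_of_lt_firstDiff
    ((pow_lt_pow_iff_right_of_lt_one₀ (by norm_num) (by norm_num)).1 hη)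

theorem ball_anti (ξ : T.Boundary) {m n : ℕ} (h : m ≤ n) : T.ball (ξ n) ⊆ T.ball (ξ m) := by
  intro η hη
  rw [mem_ball_vertex] at hη ⊢
  exact Boundary.eq_of_le hη m h

theorem finite_isChild (v : V) : {w | T.IsChild v w}.Finite :=
  (T.locallyFinite v).subset fun _ h => h.1

theorem finite_level (n : ℕ) : (Set.range fun ξ : T.Boundary => ξ n).Finite := by
  induction n with
  | zero => exact (Set.finite_singleton T.root).subset (by rintro _ ⟨ξ, rfl⟩; exact ξ.vertex_zero)
  | succ n ih =>
    refine (ih.biUnion fun v _ => finite_isChild (T := T) v).subset ?_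
    rintro _ ⟨ξ, rfl⟩
    exact Set.mem_biUnion ⟨ξ, rfl⟩ (ξ.isChild n)

/-- Compactness of the boundary, in the form of König's lemma. -/
theorem exists_uniform_level (Good : Set T.Boundary → Prop)
    (mono : ∀ A B, A ⊆ B → Good B → Good A) (h : ∀ ξ : T.Boundary, ∃ n, Good (T.ball (ξ n))) :
    ∃ N, ∀ ξ : T.Boundary, Good (T.ball (ξ N)) := by
  by_contra! hbad
  let Bad : V → Prop := fun v => ∀ N, ∃ ξ ∈ T.ball v, ¬ Good (T.ball (ξ N))
  have step : ∀ v, Bad v → ∃ w, T.IsChild v w ∧ Bad w := by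
    intro v hv
    by_contra! hc
    have hc' : ∀ w, ∃ N, T.IsChild v w → ∀ ξ ∈ T.ball w, Good (T.ball (ξ N)) := by
      intro w
      by_cases hw : T.IsChild v w
      · have := hc w hw
        simp only [Bad] at this
        push Not at this
        exact this.imp fun N hN _ => hN
      · exact ⟨0, fun h => absurd h hw⟩
    choose N hN using hc'
    obtain ⟨M, hM⟩ := ((finite_isChild (T := T) v).image N).bddAbove
    obtain ⟨ξ, ⟨n, hn⟩, hξ⟩ := hv M
    have hch : T.IsChild v (ξ (n + 1)) := hn ▸ ξ.isChild n
    exact hξ (mono _ _ (ball_anti ξ (hM ⟨_, hch, rfl⟩)) (hN _ hch ξ ⟨n + 1, rfl⟩))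
  choose! f hf using step
  have hroot : Bad T.root := fun N => by
    obtain ⟨ξ, hξ⟩ := hbad N
    exact ⟨ξ, ⟨0, ξ.vertex_zero⟩, hξ⟩
  have hall : ∀ n, Bad (f^[n] T.root) := by
    intro n
    induction n with
    | zero => exact hroot
    | succ n ih => rw [Function.iterate_succ_apply']; exact (hf _ ih).2
  let ξ : T.Boundary := ⟨fun n => f^[n] T.root, rfl, fun n => by
    rw [Function.iterate_succ_apply']; exact (hf _ (hall n)).1⟩
  obtain ⟨n, hn⟩ := h ξ
  obtain ⟨η, hη, hη'⟩ := hall n n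
  rw [mem_ball_vertex.1 (show η ∈ T.ball (ξ n) from hη)] at hη'
  exact hη' hn

/-- `g` is an order-preserving homothety on `A`. -/
def IsGoodOn (o : T.ChildOrders) (g : T.Boundary ≃ₜ T.Boundary) (A : Set T.Boundary) : Prop :=
  (∃ c : ℝ, 0 < c ∧ ∀ y ∈ A, ∀ z ∈ A, dist (g y) (g z) = c * dist y z) ∧
    ∀ ξ ∈ A, ∀ η ∈ A, o.boundaryLT ξ η → o.boundaryLT (g ξ) (g η)

theorem isHigmanThompson_iff_local (o : T.ChildOrders) (g : T.Boundary ≃ₜ T.Boundary) :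
    IsHigmanThompson o g ↔ ∀ ξ : T.Boundary, ∃ n, IsGoodOn o g (T.ball (ξ n)) := by
  constructor
  · rintro ⟨P, ⟨-, hpart, hball, hhom⟩, hord⟩ ξ
    obtain ⟨D, ⟨hD, hξ⟩, -⟩ := hpart.2 ξ
    obtain ⟨v, rfl⟩ := hball D hD
    obtain ⟨n, rfl⟩ := id hξ
    exact ⟨n, hhom _ hD, hord _ hD⟩
  · intro h
    obtain ⟨N, hN⟩ := exists_uniform_level (IsGoodOn o g)
      (fun A B hAB hB => ⟨hB.1.imp fun c hc => ⟨hc.1, fun y hy z hz => hc.2 y (hAB hy) z (hAB hz)⟩,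
        fun ξ hξ η hη => hB.2 ξ (hAB hξ) η (hAB hη)⟩) h
    refine ⟨Set.range fun ξ : T.Boundary => T.ball (ξ N), ⟨?_, ⟨?_, ?_⟩, ?_, ?_⟩, ?_⟩
    · refine ((finite_level (T := T) N).image T.ball).subset ?_
      rintro _ ⟨ξ, rfl⟩
      exact ⟨_, ⟨ξ, rfl⟩, rfl⟩
    · rintro ⟨ξ, hξ⟩
      have : ξ ∈ T.ball (ξ N) := ⟨N, rfl⟩
      simp only at hξ
      rw [hξ] at this
      exact this
    · intro ξ
      refine ⟨T.ball (ξ N), ⟨⟨ξ, rfl⟩, ⟨N, rfl⟩⟩, ?_⟩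
      rintro _ ⟨⟨η, rfl⟩, hη⟩
      simp only at hη ⊢
      rw [mem_ball_vertex.1 hη]
    · rintro _ ⟨ξ, rfl⟩; exact ⟨_, rfl⟩
    · rintro _ ⟨ξ, rfl⟩; exact (hN ξ).1
    · rintro _ ⟨ξ, rfl⟩; exact (hN ξ).2

theorem ChildOrders.boundaryLT_trichotomy (o : T.ChildOrders) (ξ η : T.Boundary) :
    o.boundaryLT ξ η ∨ ξ = η ∨ o.boundaryLT η ξ := by
  by_cases hne : ξ = η
  · exact Or.inr (Or.inl hne)
  have hne' : ξ.vertex ≠ η.vertex := fun e => hne (Boundary.coe_injective e)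
  have hd := PiNat.apply_firstDiff_ne hne'
  have hlt : ∀ m < PiNat.firstDiff ξ.vertex η.vertex, ξ m = η m :=
    fun m hm => PiNat.apply_eq_of_lt_firstDiff hm
  generalize PiNat.firstDiff ξ.vertex η.vertex = N at hd hlt
  obtain _ | n := N
  · exact absurd (ξ.vertex_zero.trans η.vertex_zero.symm) hd
  have hn : ξ n = η n := hlt n (by omega)
  have := o.isStrictTotalOrder (ξ n)
  rcases trichotomous_of (fun a b : {w // T.IsChild (ξ n) w} => o.lt (ξ n) a.1 b.1)
    ⟨ξ (n + 1), ξ.isChild n⟩ ⟨η (n + 1), hn ▸ η.isChild n⟩ with h | h | h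
  · exact Or.inl ⟨n, fun m hm => hlt m (by omega), h⟩
  · exact absurd (congrArg Subtype.val h) hd
  · exact Or.inr (Or.inr ⟨n, fun m hm => (hlt m (by omega)).symm, hn ▸ h⟩)

theorem ChildOrders.boundaryLT_irrefl (o : T.ChildOrders) (ξ : T.Boundary) :
    ¬ o.boundaryLT ξ ξ := by
  rintro ⟨n, -, h⟩
  have := o.isStrictTotalOrder (ξ n)
  exact irrefl_of (fun a b : {w // T.IsChild (ξ n) w} => o.lt (ξ n) a.1 b.1)
    ⟨ξ (n + 1), ξ.isChild n⟩ h

theorem ChildOrders.boundaryLT_asymm (o : T.ChildOrders) {ξ η : T.Boundary}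
    (h : o.boundaryLT ξ η) : ¬ o.boundaryLT η ξ := by
  obtain ⟨n, hn, h⟩ := h
  rintro ⟨m, hm, h'⟩
  have key : ∀ k, ξ k = η k → o.lt (ξ k) (ξ (k + 1)) (η (k + 1)) → ξ (k + 1) ≠ η (k + 1) := by
    intro k hk hlt he
    have := o.isStrictTotalOrder (ξ k)
    rw [← he] at hlt
    exact irrefl_of (fun a b : {w // T.IsChild (ξ k) w} => o.lt (ξ k) a.1 b.1)
      ⟨ξ (k + 1), ξ.isChild k⟩ hlt
  have key' : ∀ k, ξ k = η k → o.lt (η k) (η (k + 1)) (ξ (k + 1)) → ξ (k + 1) ≠ η (k + 1) := by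
    intro k hk hlt he
    have := o.isStrictTotalOrder (η k)
    rw [he] at hlt
    exact irrefl_of (fun a b : {w // T.IsChild (η k) w} => o.lt (η k) a.1 b.1)
      ⟨η (k + 1), η.isChild k⟩ hlt
  rcases lt_trichotomy n m with hnm | rfl | hnm
  · exact key n (hn n le_rfl) h (hm (n + 1) hnm).symm
  · have := o.isStrictTotalOrder (ξ n)
    have hs := hn n le_rfl
    rw [← hs] at h'
    exact asymm_of (fun a b : {w // T.IsChild (ξ n) w} => o.lt (ξ n) a.1 b.1)
      (a := ⟨ξ (n + 1), ξ.isChild n⟩) (b := ⟨η (n + 1), hs ▸ η.isChild n⟩) h h'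
  · exact key' m (hm m le_rfl).symm h' (hn (m + 1) hnm)

variable (T) in
/-- The Higman-Thompson group `V_T` of the tree `T` (for a fixed family of orders), as a group of
homeomorphisms of `∂T`. -/
def higmanThompson (o : T.ChildOrders) : Subgroup (T.Boundary ≃ₜ T.Boundary) where
  carrier := {g | IsHigmanThompson o g}
  one_mem' := (isHigmanThompson_iff_local o 1).2 fun _ =>
    ⟨0, ⟨1, one_pos, fun y _ z _ => by simp⟩, fun _ _ _ _ h => h⟩
  mul_mem' {g h} hg hh := by
    simp only [Set.mem_ofPred_eq, isHigmanThompson_iff_local] at hg hh ⊢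
    intro ξ
    obtain ⟨m, ⟨a, ha, hma⟩, hmo⟩ := hg (h ξ)
    obtain ⟨n, ⟨b, hb, hnb⟩, hno⟩ := hh ξ
    obtain ⟨k, hk⟩ := exists_ball_subset (ξ := ξ)
      (Filter.inter_mem (h.continuous.continuousAt (ball_mem_nhds (h ξ) m)) (ball_mem_nhds ξ n))
    refine ⟨k, ⟨a * b, mul_pos ha hb, fun y hy z hz => ?_⟩, fun η hη ζ hζ hlt => ?_⟩
    · rw [Homeomorph.mul_apply, Homeomorph.mul_apply, hma _ (hk hy).1 _ (hk hz).1,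
        hnb _ (hk hy).2 _ (hk hz).2, mul_assoc]
    · exact hmo _ (hk hη).1 _ (hk hζ).1 (hno _ (hk hη).2 _ (hk hζ).2 hlt)
  inv_mem' {g} hg := by
    simp only [Set.mem_ofPred_eq, isHigmanThompson_iff_local] at hg ⊢
    intro ξ
    obtain ⟨m, ⟨a, ha, hma⟩, hmo⟩ := hg (g.symm ξ)
    obtain ⟨k, hk⟩ := exists_ball_subset (ξ := ξ)
      (g.symm.continuous.continuousAt (ball_mem_nhds (g.symm ξ) m))
    refine ⟨k, ⟨a⁻¹, inv_pos.2 ha, fun y hy z hz => ?_⟩, fun η hη ζ hζ hlt => ?_⟩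
    · have := hma _ (hk hy) _ (hk hz)
      rw [g.apply_symm_apply, g.apply_symm_apply] at this
      change dist (g.symm y) (g.symm z) = _
      rw [this, inv_mul_cancel_left₀ ha.ne']
    · change o.boundaryLT (g.symm η) (g.symm ζ)
      rcases o.boundaryLT_trichotomy (g.symm η) (g.symm ζ) with h | h | h
      · exact h
      · rw [g.symm.injective h] at hlt
        exact absurd hlt (o.boundaryLT_irrefl _)
      · have := hmo _ (hk hζ) _ (hk hη) h
        rw [g.apply_symm_apply, g.apply_symm_apply] at this
        exact absurd this (o.boundaryLT_asymm hlt)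

end LFRootedTree

/-- The action on `X` of a group `H` of homeomorphisms has a finite orbit. -/
def HasFiniteOrbit {X : Type*} [TopologicalSpace X] (H : Subgroup (X ≃ₜ X)) : Prop :=
  ∃ x : X, {y | ∃ h ∈ H, h x = y}.Finite

/-- The action on `X` of a group `H` of homeomorphisms admits a ping-pong pair. -/
def HasPingPongPair {X : Type*} [TopologicalSpace X] (H : Subgroup (X ≃ₜ X)) : Prop :=
  ∃ g ∈ H, ∃ h ∈ H, ∃ U₁ U₂ V₁ V₂ : Set X,
    (IsOpen U₁ ∧ IsOpen U₂ ∧ IsOpen V₁ ∧ IsOpen V₂) ∧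
    (Disjoint U₁ U₂ ∧ Disjoint U₁ V₁ ∧ Disjoint U₁ V₂ ∧
      Disjoint U₂ V₁ ∧ Disjoint U₂ V₂ ∧ Disjoint V₁ V₂) ∧
    g '' U₁ᶜ ⊆ V₁ ∧ h '' U₂ᶜ ⊆ V₂

/-! Suppose that `H` has no finite orbit. The aim is a finite set `F` towards which `H` contracts
all of `∂T`: for each open `U ⊇ F`, some `g ∈ H` sends `F` and `Uᶜ` into `U`. By Neumann's lemma on
coset covers `F` has disjoint translates, and composing such elements `g` with the translating
elements gives a ping-pong pair (`ContractsOutside.hasPingPongPair`).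

Elements of `V_T` map small cones onto cones, preserving the order and shifting levels. A cone
mapped into itself without a shift is fixed pointwise, because a finite total order has no
nontrivial automorphism; with a positive shift it is contracted to a fixed point, or is a single
point (`MapsCone.fixed_or_attracts`). Such cones are found by recurrence: follow the level of a cone
along a path in an orbit, and apply the pigeonhole principle to the finitely many vertices of one
level (`exists_returning_cone`).

For the path `i ↦ g ^ i` this gives tameness: the powers `g ^ m!` push everything towards finitely
many periodic points, except for locally periodic points, which they fix. Composing such powers of
several elements leaves only the points that are hyperbolic for none of them
(`ContractsOutside.inter`). The hyperbolic sets cover `∂T` (`exists_mem_hyperbolicSet`), and then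
finitely many suffice by compactness. Finite generation enters here: an infinite orbit contains an
injective ray whose steps are generators or their inverses, these act on cones of one common level,
and injectivity excludes that a returning cone is fixed. -/

/-! ### Actions without finite orbits -/

open scoped Pointwise in
/-- If a group acts without finite orbits, any finite set can be moved off any other finite set. -/
theorem MulAction.exists_smul_notMem_of_infinite_orbits {G X : Type*} [Group G] [MulAction G X]
    (h : ∀ x : X, (MulAction.orbit G x).Infinite) {A B : Set X} (hA : A.Finite) (hB : B.Finite) :
    ∃ g : G, ∀ a ∈ A, g • a ∉ B := by
  classical
  by_contra! hcon
  -- The elements taking `a` to `b` form a left coset of the stabilizer of `a`. If the claim fails,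
  -- finitely many of these cosets cover `G`, and by Neumann's lemma some stabilizer has finite
  -- index.
  have hk : ∀ i : X × X, ∃ k : G, (∃ g : G, g • i.1 = i.2) → k • i.1 = i.2 := fun i => by
    by_cases hi : ∃ g : G, g • i.1 = i.2
    · exact hi.imp fun _ hg _ => hg
    · exact ⟨1, fun h => absurd h hi⟩
  choose k hk using hk
  have hcov : ⋃ i ∈ (hA.prod hB).toFinset, k i • (MulAction.stabilizer G i.1 : Set G) =
      Set.univ := by
    refine Set.eq_univ_of_forall fun g => ?_
    obtain ⟨a, ha, hb⟩ := hcon g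
    refine Set.mem_biUnion (x := (a, g • a)) (by simp [ha, hb]) ?_
    rw [mem_leftCoset_iff, SetLike.mem_coe, MulAction.mem_stabilizer_iff, mul_smul,
      inv_smul_eq_iff]
    exact (hk (a, g • a) ⟨g, rfl⟩).symm
  obtain ⟨i, -, hi⟩ := Subgroup.exists_finiteIndex_of_leftCoset_cover hcov
  refine h i.1 (Set.finite_of_ncard_ne_zero ?_)
  rw [← MulAction.index_stabilizer]
  exact hi.index_ne_zero

section Dynamics

variable {X : Type*} [TopologicalSpace X]

/-- If `H` has no finite orbit, any finite set can be moved off any other finite set. -/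
theorem exists_notMem_of_not_hasFiniteOrbit {H : Subgroup (X ≃ₜ X)} (hH : ¬ HasFiniteOrbit H)
    {A B : Set X} (hA : A.Finite) (hB : B.Finite) : ∃ h ∈ H, ∀ a ∈ A, h a ∉ B := by
  let _ : MulAction H X :=
    { smul := fun h x => (h : X ≃ₜ X) x
      one_smul := fun _ => rfl
      mul_smul := fun _ _ _ => rfl }
  have horb : ∀ x : X, (MulAction.orbit H x).Infinite := fun x hx => hH ⟨x, hx.subset <| by
    rintro _ ⟨h, hh, rfl⟩
    exact ⟨⟨h, hh⟩, rfl⟩⟩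
  obtain ⟨g, hg⟩ := MulAction.exists_smul_notMem_of_infinite_orbits horb hA hB
  exact ⟨g, g.2, hg⟩

/-! ### Contraction towards finite sets -/

/-- For every neighbourhood `U` of `F`, some element of `H` maps `F` into `U` and maps every point
outside `U` into `U`, except that it may fix points of `N`. -/
def ContractsOutside (H : Subgroup (X ≃ₜ X)) (N F : Set X) : Prop :=
  ∀ U, IsOpen U → F ⊆ U →
    ∃ g ∈ H, (∀ r ∈ F, g r ∈ U) ∧ ∀ x ∉ U, g x ∈ U ∨ (x ∈ N ∧ g x = x)

/-- Apply `g₁`, then `g₂`, where `g₁` contracts into a neighbourhood that `g₂` still maps into `U`.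
A point that `g₁` fixes is left to `g₂`, so only points of `N₁ ∩ N₂` can escape. -/
theorem ContractsOutside.inter [T1Space X] {H : Subgroup (X ≃ₜ X)} {N₁ N₂ F₁ F₂ : Set X}
    (h₁ : ContractsOutside H N₁ F₁) (h₂ : ContractsOutside H N₂ F₂)
    (hF₁ : F₁.Finite) (hF₂ : F₂.Finite) : ContractsOutside H (N₁ ∩ N₂) (F₁ ∪ F₂) := by
  intro U hU hFU
  -- Removing `F₁ \ F₂` from `U` puts these points outside the neighbourhood, so `g₂` moves them
  -- into it or fixes them; in both cases they end in `U`. The removal of `F₂ \ F₁` below plays the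
  -- same role for `g₁`.
  obtain ⟨g₂, hg₂, hF₂U, hN₂⟩ := h₂ (U \ (F₁ \ F₂)) (hU.sdiff hF₁.sdiff.isClosed)
    fun x hx => ⟨hFU (Or.inr hx), fun h => h.2 hx⟩
  have hF₁U : ∀ a ∈ F₁, g₂ a ∈ U := by
    intro a ha
    by_cases ha₂ : a ∈ F₂
    · exact (hF₂U a ha₂).1
    · rcases hN₂ a (fun h => h.2 ⟨ha, ha₂⟩) with h | h
      · exact h.1
      · rw [h.2]; exact hFU (Or.inl ha)
  obtain ⟨g₁, hg₁, hF₁', hN₁⟩ := h₁ ((U ∩ g₂ ⁻¹' U) \ (F₂ \ F₁))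
    ((hU.inter (hU.preimage g₂.continuous)).sdiff hF₂.sdiff.isClosed)
    fun x hx => ⟨⟨hFU (Or.inl hx), hF₁U x hx⟩, fun h => h.2 hx⟩
  refine ⟨g₂ * g₁, H.mul_mem hg₂ hg₁, fun r hr => ?_, fun x hx => ?_⟩
  · rw [Homeomorph.mul_apply]
    by_cases hr₁ : r ∈ F₁
    · exact (hF₁' r hr₁).1.2
    · have hr₂ : r ∈ F₂ := hr.resolve_left hr₁
      rcases hN₁ r (fun h => h.2 ⟨hr₂, hr₁⟩) with h | h
      · exact h.1.2
      · rw [h.2]; exact (hF₂U r hr₂).1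
  · rw [Homeomorph.mul_apply]
    rcases hN₁ x (fun h => hx h.1.1) with h | h
    · exact Or.inl h.1.2
    · rw [h.2]
      rcases hN₂ x (fun h => hx h.1) with h' | h'
      · exact Or.inl h'.1
      · exact Or.inr ⟨⟨h.1, h'.1⟩, h'.2⟩

/-- A group without finite orbits which contracts the whole space towards a finite set has a
ping-pong pair. -/
theorem ContractsOutside.hasPingPongPair [T2Space X] {H : Subgroup (X ≃ₜ X)} {F : Set X}
    (hF : F.Finite) (hc : ContractsOutside H ∅ F) (hH : ¬ HasFiniteOrbit H) :
    HasPingPongPair H := by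
  have key : ∀ k ∈ H, ∀ h ∈ H, ∀ U V, IsOpen U → IsOpen V → k '' F ⊆ U → h '' F ⊆ V →
      ∃ g ∈ H, g '' Uᶜ ⊆ V := by
    intro k hk h hh U V hU hV hkU hhV
    obtain ⟨g, hg, -, hgU⟩ := hc (k ⁻¹' U ∩ h ⁻¹' V)
      ((hU.preimage k.continuous).inter (hV.preimage h.continuous))
      fun x hx => ⟨hkU ⟨x, hx, rfl⟩, hhV ⟨x, hx, rfl⟩⟩
    refine ⟨h * g * k⁻¹, H.mul_mem (H.mul_mem hh hg) (H.inv_mem hk), ?_⟩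
    rintro _ ⟨x, hx, rfl⟩
    rcases hgU (k⁻¹ x) (fun h => hx (by simpa using h.1)) with h' | h'
    · exact h'.2
    · exact absurd h'.1 (Set.notMem_empty _)
  have move : ∀ B : Set X, B.Finite → ∃ h ∈ H, Disjoint (h '' F) B := fun B hB => by
    obtain ⟨h, hh, hd⟩ := exists_notMem_of_not_hasFiniteOrbit hH hF hB
    refine ⟨h, hh, Set.disjoint_left.2 ?_⟩
    rintro _ ⟨x, hx, rfl⟩
    exact hd x hx
  -- Four disjoint copies of `F` are needed, one inside each ping-pong set: `F` and `h₂ F` for `U₁`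
  -- and `U₂`, `h₁ F` and `h₃ F` for `V₁` and `V₂`.
  obtain ⟨h₁, hh₁, hd₁⟩ := move F hF
  obtain ⟨h₂, hh₂, hd₂⟩ := move (F ∪ h₁ '' F) (hF.union (hF.image _))
  obtain ⟨h₃, hh₃, hd₃⟩ := move (F ∪ h₁ '' F ∪ h₂ '' F)
    ((hF.union (hF.image _)).union (hF.image _))
  rw [Set.disjoint_union_right] at hd₂ hd₃
  rw [Set.disjoint_union_right] at hd₃
  obtain ⟨W, hW, hdis⟩ := Set.Finite.t2_separation
    (((hF.union (hF.image h₁)).union (hF.image h₂)).union (hF.image h₃))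
  have hopen : ∀ A : Set X, IsOpen (⋃ x ∈ A, W x) := fun A =>
    isOpen_biUnion fun x _ => (hW x).2
  have hsub : ∀ A : Set X, A ⊆ ⋃ x ∈ A, W x := fun A x hx => Set.mem_biUnion hx (hW x).1
  have hdisj : ∀ A B : Set X, A ⊆ F ∪ h₁ '' F ∪ h₂ '' F ∪ h₃ '' F →
      B ⊆ F ∪ h₁ '' F ∪ h₂ '' F ∪ h₃ '' F → Disjoint A B →
      Disjoint (⋃ x ∈ A, W x) (⋃ x ∈ B, W x) := by
    intro A B hA hB hAB
    simp only [Set.disjoint_iUnion_left, Set.disjoint_iUnion_right]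
    intro a ha b hb
    exact hdis (hA hb) (hB ha) (fun e => Set.disjoint_left.1 hAB hb (e ▸ ha))
  have s₀ : F ⊆ F ∪ h₁ '' F ∪ h₂ '' F ∪ h₃ '' F := fun x hx => by simp [hx]
  have s₁ : h₁ '' F ⊆ F ∪ h₁ '' F ∪ h₂ '' F ∪ h₃ '' F := fun x hx => Or.inl (Or.inl (Or.inr hx))
  have s₂ : h₂ '' F ⊆ F ∪ h₁ '' F ∪ h₂ '' F ∪ h₃ '' F := fun x hx => Or.inl (Or.inr hx)
  have s₃ : h₃ '' F ⊆ F ∪ h₁ '' F ∪ h₂ '' F ∪ h₃ '' F := fun x hx => Or.inr hx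
  obtain ⟨g, hg, hgU⟩ := key 1 H.one_mem h₁ hh₁ (⋃ x ∈ F, W x) (⋃ x ∈ h₁ '' F, W x)
    (hopen _) (hopen _) (by rintro _ ⟨x, hx, rfl⟩; exact hsub F hx) (hsub _)
  obtain ⟨g', hg', hgU'⟩ := key h₂ hh₂ h₃ hh₃ (⋃ x ∈ h₂ '' F, W x) (⋃ x ∈ h₃ '' F, W x)
    (hopen _) (hopen _) (hsub _) (hsub _)
  exact ⟨g, hg, g', hg', _, _, _, _, ⟨hopen _, hopen _, hopen _, hopen _⟩,
    ⟨hdisj _ _ s₀ s₂ hd₂.1.symm, hdisj _ _ s₀ s₁ hd₁.symm, hdisj _ _ s₀ s₃ hd₃.1.1.symm,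
      hdisj _ _ s₂ s₁ hd₂.2, hdisj _ _ s₂ s₃ hd₃.2.symm, hdisj _ _ s₁ s₃ hd₃.1.2.symm⟩,
    hgU, hgU'⟩

/-! ### Attracting sets and tame homeomorphisms -/

open Filter Topology

/-- `f` maps the open set `B` strictly inside itself and its iterates contract `B` to the fixed
point `a`. -/
structure Attracts (f : X ≃ₜ X) (B : Set X) (a : X) : Prop where
  isOpen : IsOpen B
  mem : a ∈ B
  fixed : f a = a
  image_ne : f '' B ≠ B
  eventually_mapsTo : ∀ U ∈ 𝓝 a, ∀ᶠ n : ℕ in atTop, ∀ y ∈ B, (f ^ n) y ∈ U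

/-- The subgroup of homeomorphisms fixing a point. -/
def homeoStabilizer (x : X) : Subgroup (X ≃ₜ X) where
  carrier := {g | g x = x}
  one_mem' := rfl
  mul_mem' {g h} hg hh := show g (h x) = x by rw [show h x = x from hh]; exact hg
  inv_mem' {g} hg := g.symm_apply_eq.2 (Eq.symm hg)

theorem mem_homeoStabilizer {x : X} {g : X ≃ₜ X} : g ∈ homeoStabilizer x ↔ g x = x := Iff.rfl

/-- A periodic point `y ≠ a` of `B` would keep returning to itself, although the iterates of `B` end
up in the neighbourhood `{y}ᶜ` of `a`. -/
theorem Attracts.eq_of_pow_apply_eq [T1Space X] {f : X ≃ₜ X} {B : Set X} {a y : X}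
    (h : Attracts f B a) (hy : y ∈ B) {n : ℕ} (hn : 0 < n) (hper : (f ^ n) y = y) : y = a := by
  by_contra hne
  obtain ⟨m, hm⟩ := eventually_atTop.1
    (h.eventually_mapsTo {y}ᶜ (isOpen_compl_singleton.mem_nhds (Ne.symm hne)))
  refine hm (n * m) (Nat.le_mul_of_pos_left m hn) y hy ?_
  rw [pow_mul]
  exact (homeoStabilizer y).pow_mem hper m

theorem Attracts.eq_of_periodic [T1Space X] {g : X ≃ₜ X} {p : ℤ} {B : Set X} {a y : X}
    (h : Attracts (g ^ p) B a) (hy : y ∈ B) {n : ℕ} (hn : 0 < n) (hper : (g ^ n) y = y) :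
    y = a := by
  refine h.eq_of_pow_apply_eq hy hn ?_
  rw [← zpow_natCast, zpow_comm, zpow_natCast]
  exact (homeoStabilizer y).zpow_mem hper p

/-- The union of all sets which are contracted by some power of `g`. -/
def hyperbolicSet (g : X ≃ₜ X) : Set X :=
  {x | ∃ (p : ℤ) (B : Set X) (a : X), Attracts (g ^ p) B a ∧ x ∈ B}

theorem isOpen_hyperbolicSet (g : X ≃ₜ X) : IsOpen (hyperbolicSet g) := by
  rw [isOpen_iff_mem_nhds]
  rintro x ⟨p, B, a, h, hx⟩
  exact mem_of_superset (h.isOpen.mem_nhds hx) fun y hy => ⟨p, B, a, h, hy⟩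

theorem Attracts.conj {f : X ≃ₜ X} {B : Set X} {a : X} (h : Attracts f B a) (k : X ≃ₜ X) :
    Attracts (k * f * k⁻¹) (k '' B) (k a) where
  isOpen := k.isOpenMap _ h.isOpen
  mem := ⟨a, h.mem, rfl⟩
  fixed := by simp [h.fixed]
  image_ne := by
    have : (k * f * k⁻¹) '' (k '' B) = k '' (f '' B) := by
      simp only [Set.image_image]
      simp
    rw [this]
    exact fun e => h.image_ne (k.injective.image_injective e)
  eventually_mapsTo U hU := by
    filter_upwards [h.eventually_mapsTo (k ⁻¹' U) (k.continuous.continuousAt hU)] with n hn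
    rintro _ ⟨y, hy, rfl⟩
    rw [conj_pow]
    simpa using hn y hy

theorem apply_mem_hyperbolicSet {g : X ≃ₜ X} {x : X} (hx : x ∈ hyperbolicSet g) (n : ℕ) :
    (g ^ n) x ∈ hyperbolicSet g := by
  obtain ⟨p, B, a, h, hx⟩ := hx
  have := h.conj (g ^ n)
  rw [(((Commute.refl g).pow_left n).zpow_right p).eq, mul_inv_cancel_right] at this
  exact ⟨p, _, _, this, x, hx, rfl⟩

/-- A contracted set has only one periodic point, so `x` is its centre. Some iterate of `g ^ p`
carries all of `B` to where `g ^ n` is the identity, and commutes with `g ^ n`, so every point of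
`B` is periodic. Thus `B = {x}`, which `image_ne` excludes. -/
theorem notMem_hyperbolicSet_of_eventually_fixed [T1Space X] {g : X ≃ₜ X} {x : X} {n : ℕ}
    (hn : 0 < n) (h : ∀ᶠ y in 𝓝 x, (g ^ n) y = y) : x ∉ hyperbolicSet g := by
  rintro ⟨p, B, a, hB, hx⟩
  obtain rfl := hB.eq_of_periodic hx hn h.self_of_nhds
  obtain ⟨m, hm⟩ := (hB.eventually_mapsTo _ h).exists
  have hsing : ∀ y ∈ B, y = x := by
    intro y hy
    refine hB.eq_of_periodic hy hn (((g ^ p) ^ m).injective ?_)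
    rw [← Homeomorph.mul_apply, ← ((((Commute.refl g).pow_left n).zpow_right p).pow_right m).eq,
      Homeomorph.mul_apply]
    exact hm y hy
  obtain rfl : B = {x} := Set.eq_singleton_iff_unique_mem.2 ⟨hx, hsing⟩
  exact hB.image_ne (by rw [Set.image_singleton, hB.fixed])

/-- Every point is locally periodic for `g`, or in a set contracted by a positive power of `g`, or
the centre of a set contracted by a negative power of `g`. -/
def IsTame (g : X ≃ₜ X) : Prop :=
  ∀ x : X, (∃ n : ℕ, 0 < n ∧ ∀ᶠ y in 𝓝 x, (g ^ n) y = y) ∨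
    (∃ n : ℕ, 0 < n ∧ ∃ B a, Attracts (g ^ n) B a ∧ x ∈ B) ∨
    ∃ n : ℕ, 0 < n ∧ ∃ B, Attracts (g ^ n)⁻¹ B x

/-- The periodic points of `g` which are not locally periodic. -/
def hyperbolicPeriodicPts (g : X ≃ₜ X) : Set X :=
  {x | x ∈ hyperbolicSet g ∧ ∃ n : ℕ, 0 < n ∧ (g ^ n) x = x}

theorem apply_mem_hyperbolicPeriodicPts {g : X ≃ₜ X} {x : X} (hx : x ∈ hyperbolicPeriodicPts g)
    (n : ℕ) : (g ^ n) x ∈ hyperbolicPeriodicPts g := by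
  obtain ⟨hx, m, hm, hper⟩ := hx
  refine ⟨apply_mem_hyperbolicSet hx n, m, hm, ?_⟩
  rw [← Homeomorph.mul_apply, ← pow_add, add_comm, pow_add, Homeomorph.mul_apply, hper]

theorem Attracts.mem_hyperbolicPeriodicPts {g : X ≃ₜ X} {n : ℕ} {B : Set X} {a : X}
    (hn : 0 < n) (h : Attracts (g ^ n) B a) : a ∈ hyperbolicPeriodicPts g :=
  ⟨⟨n, B, a, by rwa [zpow_natCast], h.mem⟩, n, hn, h.fixed⟩

theorem Attracts.mem_hyperbolicPeriodicPts_of_inv {g : X ≃ₜ X} {n : ℕ} {B : Set X} {a : X}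
    (hn : 0 < n) (h : Attracts (g ^ n)⁻¹ B a) : a ∈ hyperbolicPeriodicPts g :=
  ⟨⟨-n, B, a, by rwa [zpow_neg, zpow_natCast], h.mem⟩, n, hn,
    inv_mem_iff.1 (mem_homeoStabilizer.2 h.fixed)⟩

theorem IsTame.eventually_fixed {g : X ≃ₜ X} (hg : IsTame g) {x : X} (hx : x ∉ hyperbolicSet g) :
    ∃ n : ℕ, 0 < n ∧ ∀ᶠ y in 𝓝 x, (g ^ n) y = y := by
  rcases hg x with h | ⟨n, hn, B, a, h, hxB⟩ | ⟨n, hn, B, h⟩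
  · exact h
  · exact absurd ⟨n, B, a, by rwa [zpow_natCast], hxB⟩ hx
  · exact absurd (h.mem_hyperbolicPeriodicPts_of_inv hn).1 hx

/-- By compactness, local finiteness is enough: a contracted set contains no periodic point but its
centre, and a point outside the hyperbolic set has a neighbourhood of locally periodic points. -/
theorem IsTame.finite_hyperbolicPeriodicPts [CompactSpace X] [T1Space X] {g : X ≃ₜ X}
    (hg : IsTame g) : (hyperbolicPeriodicPts g).Finite := by
  have : (Set.univ ∩ hyperbolicPeriodicPts g).Finite := by
    refine isCompact_univ.induction_on (p := fun s => (s ∩ hyperbolicPeriodicPts g).Finite)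
      (by simp) (fun s t hst ht => ht.subset (Set.inter_subset_inter_left _ hst))
      (fun s t hs ht => by rw [Set.union_inter_distrib_right]; exact hs.union ht) fun x _ => ?_
    rw [nhdsWithin_univ]
    by_cases hx : x ∈ hyperbolicSet g
    · obtain ⟨p, B, a, h, hxB⟩ := hx
      refine ⟨B, h.isOpen.mem_nhds hxB, (Set.finite_singleton a).subset ?_⟩
      rintro y ⟨hyB, -, n, hn, hy⟩
      exact h.eq_of_periodic hyB hn hy
    · obtain ⟨n, hn, h⟩ := hg.eventually_fixed hx
      refine ⟨_, eventually_eventually_nhds.2 h, Set.finite_empty.subset ?_⟩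
      rintro y ⟨hy, hy', -⟩
      exact notMem_hyperbolicSet_of_eventually_fixed hn hy hy'
  simpa using this

/-- The compact set `Uᶜ` splits into finitely many pieces, each with its own exponent `n`; the
factorials `m!` are eventually multiples of all of them. Repelling centres lie in `U` already. -/
theorem IsTame.contractsOutside [CompactSpace X] [T1Space X] {H : Subgroup (X ≃ₜ X)} {g : X ≃ₜ X}
    (hg : IsTame g) (hgH : g ∈ H) :
    ContractsOutside H (hyperbolicSet g)ᶜ (hyperbolicPeriodicPts g) := by
  intro U hU hFU
  have : ∀ᶠ m : ℕ in atTop, ∀ x ∈ Uᶜ,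
      (g ^ m.factorial) x ∈ U ∨ (x ∈ (hyperbolicSet g)ᶜ ∧ (g ^ m.factorial) x = x) := by
    refine hU.isClosed_compl.isCompact.induction_on
      (p := fun s => ∀ᶠ m : ℕ in atTop, ∀ x ∈ s,
        (g ^ m.factorial) x ∈ U ∨ (x ∈ (hyperbolicSet g)ᶜ ∧ (g ^ m.factorial) x = x))
      (by simp) (fun s t hst ht => ht.mono fun m hm x hx => hm x (hst hx))
      (fun s t hs ht => ?_) fun x hx => ?_
    · filter_upwards [hs, ht] with m hs ht x hx
      exact hx.elim (hs x) (ht x)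
    rcases hg x with ⟨n, hn, h⟩ | ⟨n, hn, B, a, h, hxB⟩ | ⟨n, hn, B, h⟩
    · refine ⟨_, mem_nhdsWithin_of_mem_nhds (eventually_eventually_nhds.2 h), ?_⟩
      filter_upwards [eventually_ge_atTop n] with m hm y hy
      refine Or.inr ⟨notMem_hyperbolicSet_of_eventually_fixed hn hy, ?_⟩
      obtain ⟨k, hk⟩ := Nat.dvd_factorial hn hm
      rw [hk, pow_mul]
      have hy' : (g ^ n) y = y := Eventually.self_of_nhds (p := fun z => (g ^ n) z = z) hy
      exact (homeoStabilizer y).pow_mem hy' k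
    · refine ⟨B, mem_nhdsWithin_of_mem_nhds (h.isOpen.mem_nhds hxB), ?_⟩
      obtain ⟨N, hN⟩ := eventually_atTop.1
        (h.eventually_mapsTo U (hU.mem_nhds (hFU (h.mem_hyperbolicPeriodicPts hn))))
      -- This bound makes `n` divide `m!` with a quotient `k ≥ N`.
      filter_upwards [eventually_ge_atTop (n * (N + 1))] with m hm y hy
      obtain ⟨k, hk⟩ := Nat.dvd_factorial hn (le_trans (Nat.le_mul_of_pos_right n N.succ_pos) hm)
      rw [hk, pow_mul]
      refine Or.inl (hN k ?_ y hy)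
      have h1 : n * (N + 1) ≤ n * k := hk ▸ hm.trans m.self_le_factorial
      exact N.le_succ.trans (Nat.le_of_mul_le_mul_left h1 hn)
    · exact absurd (hFU (h.mem_hyperbolicPeriodicPts_of_inv hn)) hx
  obtain ⟨m, hm⟩ := this.exists
  exact ⟨g ^ m.factorial, H.pow_mem hgH _,
    fun r hr => hFU (apply_mem_hyperbolicPeriodicPts hr _), hm⟩

/-- A group of tame homeomorphisms without finite orbits whose hyperbolic sets cover the space has
a ping-pong pair. -/
theorem hasPingPongPair_of_isTame [CompactSpace X] [T2Space X] {H : Subgroup (X ≃ₜ X)}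
    (htame : ∀ g ∈ H, IsTame g) (hcov : ∀ x, ∃ g ∈ H, x ∈ hyperbolicSet g)
    (hH : ¬ HasFiniteOrbit H) : HasPingPongPair H := by
  -- `N` shrinks as the set to be avoided grows; for the whole space it is empty.
  have : ∃ N F : Set X, F.Finite ∧ ContractsOutside H N F ∧ Disjoint N Set.univ := by
    refine isCompact_univ.induction_on
      (p := fun s => ∃ N F : Set X, F.Finite ∧ ContractsOutside H N F ∧ Disjoint N s)
      ⟨Set.univ, ∅, Set.finite_empty, fun U _ _ => ⟨1, H.one_mem, by simp, by simp⟩, by simp⟩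
      (fun s t hst => ?_) ?_ fun x _ => ?_
    · rintro ⟨N, F, hF, hc, hd⟩
      exact ⟨N, F, hF, hc, hd.mono_right hst⟩
    · rintro s t ⟨N₁, F₁, hF₁, hc₁, hd₁⟩ ⟨N₂, F₂, hF₂, hc₂, hd₂⟩
      exact ⟨N₁ ∩ N₂, F₁ ∪ F₂, hF₁.union hF₂, hc₁.inter hc₂ hF₁ hF₂,
        Set.disjoint_union_right.2 ⟨hd₁.mono_left Set.inter_subset_left,
          hd₂.mono_left Set.inter_subset_right⟩⟩
    · obtain ⟨g, hg, hx⟩ := hcov x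
      rw [nhdsWithin_univ]
      exact ⟨_, (isOpen_hyperbolicSet g).mem_nhds hx, _, _,
        (htame g hg).finite_hyperbolicPeriodicPts, (htame g hg).contractsOutside hg,
        disjoint_compl_left⟩
  obtain ⟨N, F, hF, hc, hd⟩ := this
  rw [Set.disjoint_univ] at hd
  subst hd
  exact hc.hasPingPongPair hF hH

end Dynamics

/-! ### Geodesic rays in infinite orbits -/

section Rays

variable {X : Type*} [TopologicalSpace X]

/-- The points reached from a point by applying `k` elements of `S`. -/
def pathEnds (S : Set (X ≃ₜ X)) : ℕ → X → Set X
  | 0, y => {y}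
  | k + 1, y => ⋃ s ∈ S, pathEnds S k (s y)

theorem mem_pathEnds_add {S : Set (X ≃ₜ X)} {j k : ℕ} {x y z : X} (hy : y ∈ pathEnds S j x)
    (hz : z ∈ pathEnds S k y) : z ∈ pathEnds S (j + k) x := by
  induction j generalizing x with
  | zero =>
    obtain rfl : y = x := hy
    rwa [Nat.zero_add]
  | succ j ih =>
    obtain ⟨s, hs, hy⟩ := Set.mem_iUnion₂.1 hy
    rw [Nat.succ_add]
    exact Set.mem_iUnion₂.2 ⟨s, hs, ih hy⟩

theorem apply_mem_pathEnds_one {S : Set (X ≃ₜ X)} {s : X ≃ₜ X} (hs : s ∈ S) (x : X) :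
    s x ∈ pathEnds S 1 x :=
  Set.mem_iUnion₂.2 ⟨s, hs, rfl⟩

theorem exists_mem_pathEnds_of_mem_closure {S : Set (X ≃ₜ X)} {h : X ≃ₜ X}
    (hh : h ∈ Subgroup.closure S) (x : X) : ∃ k, h x ∈ pathEnds (S ∪ S⁻¹) k x := by
  induction hh using Subgroup.closure_induction_left with
  | one => exact ⟨0, rfl⟩
  | mul_left s hs g _ ih =>
    obtain ⟨k, hk⟩ := ih
    exact ⟨k + 1, mem_pathEnds_add hk (apply_mem_pathEnds_one (Or.inl hs) _)⟩
  | inv_mul_cancel s hs g _ ih =>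
    obtain ⟨k, hk⟩ := ih
    exact ⟨k + 1, mem_pathEnds_add hk
      (apply_mem_pathEnds_one (s := s⁻¹) (Or.inr (by simpa using hs)) (g x))⟩

/-- An infinite orbit of a group generated by a finite set contains an injective ray. -/
theorem exists_injective_ray {S : Set (X ≃ₜ X)} (hS : S.Finite) {x : X}
    (hx : {y | ∃ k, y ∈ pathEnds S k x}.Infinite) :
    ∃ s w : ℕ → (X ≃ₜ X), (∀ i, s i ∈ S) ∧ w 0 = 1 ∧ (∀ i, w (i + 1) = s i * w i) ∧
      Function.Injective fun i => w i x := by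
  classical
  let Geo : ℕ → X → Prop := fun n z => ∀ m < n, z ∉ pathEnds S m x
  -- For `y` reached in `n` steps, these are the points `z` with a geodesic from `x` to `z` through
  -- `y`. As in König's lemma, an infinite tail at `y` forces one at some neighbour, `S` being
  -- finite.
  let Tail : ℕ → X → Set X := fun n y => {z | ∃ k, z ∈ pathEnds S k y ∧ Geo (n + k) z}
  have step : ∀ (n : ℕ) (v : X ≃ₜ X), (Tail n (v x)).Infinite →
      ∃ s, s ∈ S ∧ (Tail (n + 1) ((s * v) x)).Infinite := by
    intro n v hv
    by_contra! hcon
    refine hv (((Set.finite_singleton (v x)).union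
      (hS.biUnion (t := fun s => Tail (n + 1) ((s * v) x))
        fun s hs => Set.not_infinite.1 (by simpa using hcon s hs))).subset ?_)
    rintro z ⟨k, hk, hgeo⟩
    obtain _ | k := k
    · exact Or.inl hk
    · obtain ⟨s, hs, hz⟩ := Set.mem_iUnion₂.1 hk
      exact Or.inr (Set.mem_biUnion hs ⟨k, hz, by rwa [Nat.add_assoc, Nat.add_comm 1 k]⟩)
  choose! f hfS hf using step
  let w : ℕ → (X ≃ₜ X) := fun n => Nat.rec 1 (fun n v => f n v * v) n
  have hw : ∀ n, w (n + 1) = f n (w n) * w n := fun _ => rfl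
  have hinf : ∀ n, (Tail n (w n x)).Infinite := by
    intro n
    induction n with
    | zero =>
      refine hx.mono fun z hz => ?_
      refine ⟨Nat.find hz, Nat.find_spec hz, fun m hm => Nat.find_min hz ?_⟩
      rwa [Nat.zero_add] at hm
    | succ n ih => rw [hw]; exact hf n (w n) ih
  have hpath : ∀ n, w n x ∈ pathEnds S n x := by
    intro n
    induction n with
    | zero => rfl
    | succ n ih =>
      exact mem_pathEnds_add ih (apply_mem_pathEnds_one (hfS n (w n) (hinf n)) _)
  refine ⟨fun n => f n (w n), w, fun n => hfS n (w n) (hinf n), rfl, hw, ?_⟩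
  -- A repetition would be a shortcut to the points of the tail at `j`, which are at geodesic
  -- distance.
  have hne : ∀ i j, i < j → w i x ≠ w j x := by
    intro i j hij he
    obtain ⟨z, k, hk, hgeo⟩ := (hinf j).nonempty
    rw [← he] at hk
    exact hgeo (i + k) (by omega) (mem_pathEnds_add (hpath i) hk)
  intro i j he
  by_contra h
  rcases Nat.lt_or_gt_of_ne h with h | h
  · exact hne i j h he
  · exact hne j i h he.symm

end Rays

/-! ### Records of integer sequences -/

/-- If `S` is bounded below, every tail attains its minimum; otherwise take the first time that `S`
is at most `M`. -/
theorem Int.exists_records (S : ℕ → ℤ) :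
    (∀ i₀, ∃ i ≥ i₀, ∀ l ≥ i, S i ≤ S l) ∨ ∀ M, ∃ j, S j ≤ M ∧ ∀ l < j, S j < S l := by
  classical
  by_cases hb : ∃ M, ∀ i, M ≤ S i
  · obtain ⟨M, hM⟩ := hb
    refine Or.inl fun i₀ => ?_
    obtain ⟨_, ⟨i, hi, rfl⟩, hmin⟩ := Int.exists_least_of_bdd (P := fun z => ∃ l ≥ i₀, S l = z)
      ⟨M, by rintro _ ⟨l, -, rfl⟩; exact hM l⟩ ⟨S i₀, i₀, le_rfl, rfl⟩
    exact ⟨i, hi, fun l hl => hmin _ ⟨l, le_trans hi hl, rfl⟩⟩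
  · push Not at hb
    refine Or.inr fun M => ?_
    have hex : ∃ j, S j ≤ M := (hb M).imp fun _ h => h.le
    refine ⟨Nat.find hex, Nat.find_spec hex, fun l hl => ?_⟩
    have := Nat.find_min hex hl
    have := Nat.find_spec hex
    omega

theorem Finite.not_forall_rel_succ {α : Type*} [Finite α] (r : α → α → Prop) [IsTrans α r]
    [Std.Irrefl r] (f : ℕ → α) : ¬ ∀ i, r (f i) (f (i + 1)) := by
  intro h
  refine not_injective_infinite_finite f fun i j hij => ?_
  by_contra hne
  rcases Nat.lt_or_gt_of_ne hne with hlt | hlt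
  · have := Nat.rel_of_forall_rel_succ_of_lt r h hlt
    rw [hij] at this
    exact irrefl_of r _ this
  · have := Nat.rel_of_forall_rel_succ_of_lt r h hlt
    rw [hij] at this
    exact irrefl_of r _ this

/-! ### Compactness of the boundary and maps between cones -/

namespace LFRootedTree

open Filter Topology

variable {V : Type*} {T : LFRootedTree V}

instance : CompactSpace T.Boundary := by
  refine ⟨isCompact_of_finite_subcover fun {ι} U hU hcov => ?_⟩
  obtain ⟨N, hN⟩ := exists_uniform_level (T := T) (fun A => ∃ i, A ⊆ U i)
    (fun A B hAB ⟨i, hi⟩ => ⟨i, hAB.trans hi⟩) fun ξ => by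
      obtain ⟨i, hi⟩ := Set.mem_iUnion.1 (hcov (Set.mem_univ ξ))
      obtain ⟨n, hn⟩ := exists_ball_subset ((hU i).mem_nhds hi)
      exact ⟨n, i, hn⟩
  have hv : ∀ v ∈ Set.range (fun ξ : T.Boundary => ξ N), ∃ i, T.ball v ⊆ U i := by
    rintro _ ⟨ξ, rfl⟩
    exact hN ξ
  choose i hi using hv
  classical
  have := (finite_level (T := T) N).fintype
  refine ⟨Finset.univ.image fun v : Set.range (fun ξ : T.Boundary => ξ N) => i v v.2,
    fun ξ _ => ?_⟩
  exact Set.mem_biUnion (Finset.mem_coe.2 (Finset.mem_image_of_mem _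
    (Finset.mem_univ ⟨ξ N, ξ, rfl⟩))) (hi _ ⟨ξ, rfl⟩ ⟨N, rfl⟩)

theorem Boundary.apply_eq_iff_dist_lt {ξ η : T.Boundary} {n : ℕ} :
    ξ n = η n ↔ dist ξ η < (1 / 2 : ℝ) ^ n := by
  by_cases hne : ξ = η
  · subst hne
    simp
  have hne' : ξ.vertex ≠ η.vertex := fun e => hne (Boundary.coe_injective e)
  rw [Boundary.dist_of_ne hne, pow_lt_pow_iff_right_of_lt_one₀ (by norm_num) (by norm_num)]
  refine ⟨fun h => ?_, fun h => PiNat.apply_eq_of_lt_firstDiff h⟩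
  by_contra hlt
  exact PiNat.apply_firstDiff_ne hne' (Boundary.eq_of_le h _ (by omega))

/-- `g` maps the cone of ends through `ξ n` onto the cone of ends through `(g ξ) m`, preserving the
order and shifting levels by `m - n`. -/
structure MapsCone (o : T.ChildOrders) (g : T.Boundary ≃ₜ T.Boundary) (n m : ℕ)
    (ξ : T.Boundary) : Prop where
  agree : ∀ η ζ : T.Boundary, ∀ k, η n = ξ n → (ζ (n + k) = η (n + k) ↔ g ζ (m + k) = g η (m + k))
  lt : ∀ η ζ : T.Boundary, η n = ξ n → ζ n = ξ n → o.boundaryLT η ζ → o.boundaryLT (g η) (g ζ)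

namespace MapsCone

variable {o : T.ChildOrders} {g h : T.Boundary ≃ₜ T.Boundary} {n m k t : ℕ} {ξ η : T.Boundary}

/-- In `agree`, `ζ` ranges over all ends, not only those of the cone. The case `k = 0` therefore
says both that the cone maps into the target cone and that it maps onto it. -/
theorem apply_eq_iff (hg : MapsCone o g n m ξ) : η n = ξ n ↔ g η m = g ξ m :=
  hg.agree ξ η 0 rfl

theorem congr (hg : MapsCone o g n m ξ) (hη : η n = ξ n) : MapsCone o g n m η where
  agree α β k hα := hg.agree α β k (hα.trans hη)
  lt α β hα hβ := hg.lt α β (hα.trans hη) (hβ.trans hη)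

theorem add (hg : MapsCone o g n m ξ) (k : ℕ) : MapsCone o g (n + k) (m + k) ξ where
  agree α β l hα := by
    rw [Nat.add_assoc, Nat.add_assoc]
    exact hg.agree α β (k + l) (Boundary.eq_of_le hα n (by omega))
  lt α β hα hβ :=
    hg.lt α β (Boundary.eq_of_le hα n (by omega)) (Boundary.eq_of_le hβ n (by omega))

theorem one (n : ℕ) (ξ : T.Boundary) : MapsCone o 1 n n ξ where
  agree _ _ _ _ := Iff.rfl
  lt _ _ _ _ h := h

theorem mul (hh : MapsCone o h m k (g ξ)) (hg : MapsCone o g n m ξ) :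
    MapsCone o (h * g) n k ξ where
  agree α β l hα := (hg.agree α β l hα).trans (hh.agree _ _ l (hg.apply_eq_iff.1 hα))
  lt α β hα hβ hlt :=
    hh.lt _ _ (hg.apply_eq_iff.1 hα) (hg.apply_eq_iff.1 hβ) (hg.lt α β hα hβ hlt)

theorem inv (hg : MapsCone o g n m ξ) : MapsCone o g⁻¹ m n (g ξ) := by
  have hmem : ∀ α : T.Boundary, α m = g ξ m → g⁻¹ α n = ξ n := fun α hα =>
    hg.apply_eq_iff.2 (by simpa using hα)
  refine ⟨fun α β k hα => ?_, fun α β hα hβ hlt => ?_⟩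
  · have := hg.agree (g⁻¹ α) (g⁻¹ β) k (hmem α hα)
    simpa using this.symm
  · rcases o.boundaryLT_trichotomy (g⁻¹ α) (g⁻¹ β) with h | h | h
    · exact h
    · rw [g⁻¹.injective h] at hlt
      exact absurd hlt (o.boundaryLT_irrefl _)
    · have := hg.lt _ _ (hmem β hβ) (hmem α hα) h
      simp only [Homeomorph.inv_apply, Homeomorph.apply_symm_apply] at this
      exact absurd this (o.boundaryLT_asymm hlt)

theorem pow (hg : MapsCone o g n (n + t) ξ) (hξ : g ξ n = ξ n) (k : ℕ) :
    MapsCone o (g ^ k) n (n + k * t) ξ := by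
  induction k with
  | zero => simpa using MapsCone.one n ξ
  | succ k ih =>
    rw [pow_succ, Nat.succ_mul, ← Nat.add_assoc]
    have := (ih.congr hξ).add t
    exact this.mul hg

end MapsCone

theorem ChildOrders.ne_of_lt (o : T.ChildOrders) {ξ η : T.Boundary} {n : ℕ}
    (h : o.lt (ξ n) (ξ (n + 1)) (η (n + 1))) : ξ (n + 1) ≠ η (n + 1) := by
  intro he
  have := o.isStrictTotalOrder (ξ n)
  rw [← he] at h
  exact irrefl_of (fun a b : {w // T.IsChild (ξ n) w} => o.lt (ξ n) a.1 b.1)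
    ⟨ξ (n + 1), ξ.isChild n⟩ h

theorem ChildOrders.lt_of_boundaryLT (o : T.ChildOrders) {ξ η : T.Boundary} {n : ℕ}
    (h : o.boundaryLT ξ η) (hn : ξ n = η n) (hne : ξ (n + 1) ≠ η (n + 1)) :
    o.lt (ξ n) (ξ (n + 1)) (η (n + 1)) := by
  obtain ⟨m, hm, hlt⟩ := h
  obtain rfl : m = n := by
    rcases lt_trichotomy m n with h | h | h
    · exact absurd (Boundary.eq_of_le hn _ h) (o.ne_of_lt hlt)
    · exact h
    · exact absurd (hm (n + 1) h) hne
  exact hlt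

theorem Boundary.exists_firstDiff {ξ η : T.Boundary} {n : ℕ} (hn : ξ n = η n) (hne : ξ ≠ η) :
    ∃ k, ξ (n + k) = η (n + k) ∧ ξ (n + k + 1) ≠ η (n + k + 1) := by
  by_contra! hcon
  have : ∀ k, ξ (n + k) = η (n + k) := by
    intro k
    induction k with
    | zero => exact hn
    | succ k ih => exact hcon k ih
  refine hne (Boundary.ext (funext fun j => ?_))
  exact Boundary.eq_of_le (this j) j (by omega)

/-- An order-preserving isometry from a cone to itself is the identity. -/
theorem MapsCone.apply_eq_self {o : T.ChildOrders} {g : T.Boundary ≃ₜ T.Boundary} {n : ℕ}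
    {ξ η : T.Boundary} (hg : MapsCone o g n n ξ) (hξ : g ξ n = ξ n) (hη : η n = ξ n) :
    g η = η := by
  by_contra hne
  have hstep : ∀ ζ : T.Boundary, ζ n = ξ n → g ζ n = ξ n := fun ζ hζ =>
    (hg.apply_eq_iff.1 hζ).trans hξ
  obtain ⟨k, hk, hk'⟩ := Boundary.exists_firstDiff ((hstep η hη).trans hη.symm) hne
  let u : ℕ → T.Boundary := fun i => g^[i] η
  have hu : ∀ i, u (i + 1) = g (u i) := fun i => Function.iterate_succ_apply' g i η
  have hun : ∀ i, u i n = ξ n := by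
    intro i
    induction i with
    | zero => exact hη
    | succ i ih => rw [hu]; exact hstep _ ih
  have hagree : ∀ i, u (i + 1) (n + k) = u i (n + k) := by
    intro i
    induction i with
    | zero => exact hk
    | succ i ih =>
      rw [hu (i + 1), hu i] at *
      exact (hg.agree (u i) (g (u i)) k (hun i)).1 ih
  have hdiff : ∀ i, u (i + 1) (n + k + 1) ≠ u i (n + k + 1) := by
    intro i
    induction i with
    | zero => exact hk'
    | succ i ih =>
      rw [hu (i + 1), hu i] at *
      exact fun h => ih ((hg.agree (u i) (g (u i)) (k + 1) (hun i)).2 h)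
  have hbase : ∀ i, u i (n + k) = η (n + k) := by
    intro i
    induction i with
    | zero => rfl
    | succ i ih => rw [hagree, ih]
  have := o.isStrictTotalOrder (η (n + k))
  have : Finite {w // T.IsChild (η (n + k)) w} := finite_isChild _
  let c : ℕ → {w // T.IsChild (η (n + k)) w} := fun i =>
    ⟨u i (n + k + 1), hbase i ▸ (u i).isChild (n + k)⟩
  rcases o.boundaryLT_trichotomy η (g η) with h | h | h
  · have hlt : ∀ i, o.boundaryLT (u i) (u (i + 1)) := by
      intro i
      induction i with
      | zero => exact h
      | succ i ih =>
        have := hg.lt _ _ (hun i) (hun (i + 1)) ih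
        rwa [← hu, ← hu] at this
    refine Finite.not_forall_rel_succ
      (fun a b : {w // T.IsChild (η (n + k)) w} => o.lt (η (n + k)) a.1 b.1) c fun i => ?_
    have := o.lt_of_boundaryLT (hlt i) (hagree i).symm (hdiff i).symm
    rwa [hbase] at this
  · exact hne h.symm
  · have hlt : ∀ i, o.boundaryLT (u (i + 1)) (u i) := by
      intro i
      induction i with
      | zero => exact h
      | succ i ih =>
        have := hg.lt _ _ (hun (i + 1)) (hun i) ih
        rwa [← hu, ← hu] at this
    refine Finite.not_forall_rel_succ (Function.swap
      (fun a b : {w // T.IsChild (η (n + k)) w} => o.lt (η (n + k)) a.1 b.1)) c fun i => ?_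
    have := o.lt_of_boundaryLT (hlt i) (hagree i) (hdiff i)
    rwa [hbase] at this

theorem isOpen_ball (ξ : T.Boundary) (n : ℕ) : IsOpen (T.ball (ξ n)) := by
  rw [isOpen_iff_mem_nhds]
  intro η hη
  have := ball_mem_nhds η n
  rwa [mem_ball_vertex.1 hη] at this

/-- A map shrinking a cone into itself is the identity on the cone, or attracts it. -/
theorem MapsCone.fixed_or_attracts {o : T.ChildOrders} {f : T.Boundary ≃ₜ T.Boundary} {n t : ℕ}
    {ξ : T.Boundary} (hf : MapsCone o f n (n + t) ξ) (hξ : f ξ n = ξ n) :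
    (∀ η ∈ T.ball (ξ n), f η = η) ∨ ∃ a, Attracts f (T.ball (ξ n)) a := by
  rcases Nat.eq_zero_or_pos t with rfl | ht
  · exact Or.inl fun η hη => hf.apply_eq_self hξ (mem_ball_vertex.1 hη)
  have hpow := hf.pow hξ
  have hle : ∀ k, k ≤ n + k * t := fun k =>
    (Nat.le_mul_of_pos_right k ht).trans (Nat.le_add_left _ _)
  have hsucc : ∀ k, (f ^ (k + 1)) ξ (n + k * t) = (f ^ k) ξ (n + k * t) := fun k => by
    rw [pow_succ]
    exact (hpow k).apply_eq_iff.1 hξ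
  have hlim : ∀ k m, k ≤ m → (f ^ m) ξ (n + k * t) = (f ^ k) ξ (n + k * t) := by
    intro k m hkm
    induction m, hkm using Nat.le_induction with
    | base => rfl
    | succ m hkm ih =>
      rw [← ih]
      exact Boundary.eq_of_le (hsucc m) _ (by gcongr)
  -- The cones at level `n + k * t` around `f ^ k ξ` are nested. As `t > 0`, their levels tend to
  -- infinity and they shrink to one end; level `j` is settled after `j` steps.
  let a : T.Boundary := ⟨fun j => (f ^ j) ξ j, ξ.vertex_zero, fun j => by
    rw [← Boundary.eq_of_le (hsucc j) j (hle j)]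
    exact ((f ^ (j + 1)) ξ).isChild j⟩
  have ha : ∀ k, a (n + k * t) = (f ^ k) ξ (n + k * t) := fun k => hlim k _ (hle k)
  have huniq : ∀ b : T.Boundary, (∀ k, b (n + (k + 1) * t) = (f ^ (k + 1)) ξ (n + (k + 1) * t)) →
      b = a := by
    intro b hb
    refine Boundary.ext (funext fun j => ?_)
    exact Boundary.eq_of_le ((hb j).trans (ha (j + 1)).symm) j (j.le_succ.trans (hle _))
  have hball : ∀ η ∈ T.ball (ξ n), ∀ k, (f ^ k) η (n + k * t) = (f ^ k) ξ (n + k * t) :=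
    fun η hη k => (hpow k).apply_eq_iff.1 (mem_ball_vertex.1 hη)
  have hmem : a ∈ T.ball (ξ n) := mem_ball_vertex.2 (by simpa using ha 0)
  -- If `f` maps the ball onto itself despite the shift, then every point lies in all the nested
  -- cones. The ball is then the single point `a`, and `f` fixes it.
  by_cases himg : f '' T.ball (ξ n) = T.ball (ξ n)
  · have hsing : ∀ η ∈ T.ball (ξ n), η = a := by
      intro η hη
      refine huniq η fun k => ?_
      have : ∀ k, ∃ ζ ∈ T.ball (ξ n), (f ^ k) ζ = η := by
        intro k
        induction k with
        | zero => exact ⟨η, hη, rfl⟩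
        | succ k ih =>
          obtain ⟨ζ, hζ, hk⟩ := ih
          rw [← himg] at hζ
          obtain ⟨ζ', hζ', rfl⟩ := hζ
          exact ⟨ζ', hζ', by rw [pow_succ]; exact hk⟩
      obtain ⟨ζ, hζ, rfl⟩ := this (k + 1)
      exact hball ζ hζ (k + 1)
    refine Or.inl fun η hη => ?_
    have : f η ∈ T.ball (ξ n) := by
      rw [← himg]
      exact ⟨η, hη, rfl⟩
    rw [hsing _ this, hsing _ hη]
  · refine Or.inr ⟨a, isOpen_ball ξ n, hmem, huniq _ fun k => ?_, himg, fun U hU => ?_⟩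
    · have hk : (f ^ k) ξ n = ξ n := by simpa using hlim 0 k k.zero_le
      have := (hf.agree ((f ^ k) ξ) a (k * t) hk).1 (ha k)
      rw [pow_succ', Nat.succ_mul, Nat.add_comm (k * t), ← Nat.add_assoc]
      exact this
    · obtain ⟨N, hN⟩ := exists_ball_subset hU
      filter_upwards [eventually_ge_atTop N] with k hk η hη
      refine hN (mem_ball_vertex.2 ?_)
      exact Boundary.eq_of_le ((hball η hη k).trans (ha k).symm) N (hk.trans (hle k))

/-! ### Higman-Thompson elements act on small cones -/

/-- Distances are powers of `1 / 2`, so a homothety shifts first-difference levels by a constant. -/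
theorem IsHigmanThompson.exists_mapsCone {o : T.ChildOrders} {g : T.Boundary ≃ₜ T.Boundary}
    (hg : IsHigmanThompson o g) (ξ : T.Boundary) : ∃ n m, MapsCone o g n m ξ := by
  obtain ⟨n₀, ⟨c, hc, hdist⟩, hord⟩ := (isHigmanThompson_iff_local o g).1 hg ξ
  obtain ⟨m₀, hm₀⟩ := exists_ball_subset (ξ := g ξ) (U := g '' T.ball (ξ n₀))
    ((g.isOpenMap.image_mem_nhds (ball_mem_nhds ξ n₀)))
  -- The homothety factor is `2 ^ (B - A)`, read off from one pair of distinct points and stated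
  -- without division. On a one-point ball all distances vanish and `A = B = 0` serves.
  have hscale : ∃ A B : ℕ, ∀ y ∈ T.ball (ξ n₀), ∀ z ∈ T.ball (ξ n₀),
      dist (g y) (g z) * (1 / 2 : ℝ) ^ B = (1 / 2 : ℝ) ^ A * dist y z := by
    by_cases hsub : (T.ball (ξ n₀)).Subsingleton
    · exact ⟨0, 0, fun y hy z hz => by rw [hsub hy hz]; simp⟩
    · rw [Set.not_subsingleton_iff] at hsub
      obtain ⟨y, hy, z, hz, hne⟩ := hsub
      have h := hdist y hy z hz
      rw [Boundary.dist_of_ne hne, Boundary.dist_of_ne (g.injective.ne hne)] at h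
      refine ⟨PiNat.firstDiff (g y).vertex (g z).vertex, PiNat.firstDiff y.vertex z.vertex,
        fun y' hy' z' hz' => ?_⟩
      rw [h, hdist y' hy' z' hz']
      ring
  obtain ⟨A, B, hAB⟩ := hscale
  have hagree : ∀ η ∈ T.ball (ξ n₀), ∀ ζ ∈ T.ball (ξ n₀), ∀ k,
      (ζ (B + k) = η (B + k) ↔ g ζ (A + k) = g η (A + k)) := by
    intro η hη ζ hζ k
    rw [Boundary.apply_eq_iff_dist_lt, Boundary.apply_eq_iff_dist_lt,
      ← mul_lt_mul_iff_right₀ (show (0 : ℝ) < (1 / 2) ^ A by positivity), ← hAB ζ hζ η hη,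
      show (1 / 2 : ℝ) ^ A * (1 / 2) ^ (B + k) = (1 / 2) ^ (A + k) * (1 / 2) ^ B by ring,
      mul_lt_mul_iff_left₀ (by positivity)]
  -- The term `n₀` keeps the source cone inside the homothety ball; `m₀` keeps the target cone
  -- inside the image of that ball, so that every preimage lies in the ball.
  refine ⟨B + (n₀ + m₀), A + (n₀ + m₀), fun η ζ k hη => ?_, fun η ζ hη hζ => ?_⟩
  · have hη₀ : η ∈ T.ball (ξ n₀) := mem_ball_vertex.2 (Boundary.eq_of_le hη n₀ (by omega))
    rw [Nat.add_assoc B, Nat.add_assoc A]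
    refine ⟨fun h => (hagree η hη₀ ζ (mem_ball_vertex.2 ?_) _).1 h,
      fun h => (hagree η hη₀ ζ ?_ _).2 h⟩
    · exact (Boundary.eq_of_le h n₀ (by omega)).trans (mem_ball_vertex.1 hη₀)
    · have h1 : g η (A + (n₀ + m₀)) = g ξ (A + (n₀ + m₀)) :=
        (hagree ξ ⟨n₀, rfl⟩ η hη₀ _).1 hη
      have h2 : g ζ ∈ T.ball (g ξ m₀) := mem_ball_vertex.2
        ((Boundary.eq_of_le h m₀ (by omega)).trans (Boundary.eq_of_le h1 m₀ (by omega)))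
      obtain ⟨ζ', hζ', he⟩ := hm₀ h2
      exact g.injective he ▸ hζ'
  · exact hord η (mem_ball_vertex.2 (Boundary.eq_of_le hη n₀ (by omega)))
      ζ (mem_ball_vertex.2 (Boundary.eq_of_le hζ n₀ (by omega)))

theorem IsHigmanThompson.exists_level {o : T.ChildOrders} {g : T.Boundary ≃ₜ T.Boundary}
    (hg : IsHigmanThompson o g) : ∃ N, ∀ n ≥ N, ∀ ξ, ∃ m, MapsCone o g n m ξ := by
  have : ∃ N, ∀ n ≥ N, ∀ ξ ∈ Set.univ, ∃ m, MapsCone o g n m ξ := by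
    refine isCompact_univ.induction_on
      (p := fun s => ∃ N, ∀ n ≥ N, ∀ ξ ∈ s, ∃ m, MapsCone o g n m ξ) ⟨0, by simp⟩
      (fun s t hst ⟨N, hN⟩ => ⟨N, fun n hn ξ hξ => hN n hn ξ (hst hξ)⟩)
      (fun s t ⟨N, hN⟩ ⟨M, hM⟩ => ⟨max N M, fun n hn ξ hξ => hξ.elim
        (hN n ((le_max_left _ _).trans hn) ξ) (hM n ((le_max_right _ _).trans hn) ξ)⟩)
      fun ξ _ => ?_
    obtain ⟨N, m, h⟩ := hg.exists_mapsCone ξ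
    rw [nhdsWithin_univ]
    refine ⟨_, ball_mem_nhds ξ N, N, fun n hn η hη => ?_⟩
    obtain ⟨k, rfl⟩ := Nat.exists_eq_add_of_le hn
    exact ⟨m + k, (h.congr (mem_ball_vertex.1 hη)).add k⟩
  exact this.imp fun N hN n hn ξ => hN n hn ξ (Set.mem_univ ξ)

end LFRootedTree

namespace LFRootedTree

open Filter Topology

variable {V : Type*} {T : LFRootedTree V} {o : T.ChildOrders}

/-! ### Following cones along an orbit -/

/-- A cone can be followed along a path as long as its level stays at least `N`. -/
theorem MapsCone.of_path {s w : ℕ → (T.Boundary ≃ₜ T.Boundary)} (hw : ∀ i, w (i + 1) = s i * w i)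
    {ξ : T.Boundary} {S : ℕ → ℤ} {N : ℕ}
    (hs : ∀ i (a b : ℕ), N ≤ a → (b : ℤ) = a + S (i + 1) - S i → MapsCone o (s i) a b (w i ξ))
    {i j : ℕ} (hij : i ≤ j) {a b : ℕ} (ha : ∀ l, i ≤ l → l < j → (N : ℤ) ≤ a + S l - S i)
    (hb : (b : ℤ) = a + S j - S i) : MapsCone o (w j * (w i)⁻¹) a b (w i ξ) := by
  induction j, hij using Nat.le_induction generalizing b with
  | base =>
    obtain rfl : b = a := by omega
    rw [mul_inv_cancel]
    exact MapsCone.one b _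
  | succ j hij ih =>
    have hj := ha j hij j.lt_succ_self
    have ih' := ih (b := (a + S j - S i).toNat) (fun l hl hlj => ha l hl (by omega)) (by omega)
    rw [hw, mul_assoc]
    refine MapsCone.mul ?_ ih'
    have : (w j * (w i)⁻¹) (w i ξ) = w j ξ := by simp
    rw [this]
    exact hs j _ _ (by omega) (by omega)

/-- Along any path, some cone returns inside itself, either forwards or, infinitely often with
unbounded contraction, backwards. -/
theorem exists_returning_cone {s w : ℕ → (T.Boundary ≃ₜ T.Boundary)}
    (hw : ∀ i, w (i + 1) = s i * w i) (ξ : T.Boundary) {N : ℕ}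
    (hs : ∀ i η, ∃ m, MapsCone o (s i) N m η) :
    (∃ i j t : ℕ, i < j ∧ w j ξ N = w i ξ N ∧ MapsCone o (w j * (w i)⁻¹) N (N + t) (w i ξ)) ∨
    ∃ i, ∀ M : ℕ, ∃ j t : ℕ, i < j ∧ M < t ∧ w j ξ N = w i ξ N ∧
      MapsCone o (w i * (w j)⁻¹) N (N + t) (w j ξ) := by
  choose m hm using hs
  -- `S i` is the total change of level after `i` steps, for cones that never rise above level `N`
  -- on the way.
  let S : ℕ → ℤ := fun i => ∑ l ∈ Finset.range i, ((m l (w l ξ) : ℤ) - N)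
  have hS : ∀ i, S (i + 1) = S i + (m i (w i ξ) - N) := fun i => Finset.sum_range_succ _ _
  have hs' : ∀ i (a b : ℕ), N ≤ a → (b : ℤ) = a + S (i + 1) - S i →
      MapsCone o (s i) a b (w i ξ) := by
    intro i a b ha hb
    obtain ⟨k, rfl⟩ := Nat.exists_eq_add_of_le ha
    obtain rfl : b = m i (w i ξ) + k := by have := hS i; push_cast at hb; omega
    exact (hm i (w i ξ)).add k
  have hfin := finite_level (T := T) N
  rcases Int.exists_records S with hrec | hrec
  · left
    -- From such a time `i` on, the cone of level `N` at `w i ξ` can be followed forever. Two such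
    -- times share their vertex at level `N`.
    have hinf : {i | ∀ l ≥ i, S i ≤ S l}.Infinite := Set.infinite_of_forall_exists_gt fun i₀ => by
      obtain ⟨i, hi, h⟩ := hrec (i₀ + 1)
      exact ⟨i, h, hi⟩
    obtain ⟨i, hi, j, hj, hij, hv⟩ := hinf.exists_lt_map_eq_of_mapsTo
      (f := fun i => w i ξ N) (fun i _ => Set.mem_range_self (w i ξ)) hfin
    have h1 := hi j hij.le
    refine ⟨i, j, (S j - S i).toNat, hij, hv.symm, MapsCone.of_path hw hs' hij.le ?_ ?_⟩
    · intro l hl _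
      have := hi l hl
      omega
    · push_cast
      omega
  · right
    -- One vertex at level `N` must occur at arbitrarily low records, since finitely many lower
    -- bounds have a common one.
    obtain ⟨v, hv⟩ : ∃ v, ∀ M, ∃ j, S j ≤ M ∧ (∀ l < j, S j < S l) ∧ w j ξ N = v := by
      by_contra! hcon
      choose M hM using hcon
      obtain ⟨B, hB⟩ := (hfin.image M).bddBelow
      obtain ⟨j, hj, hr⟩ := hrec B
      exact hM (w j ξ N) j (hj.trans (hB ⟨_, ⟨w j ξ, rfl⟩, rfl⟩)) hr rfl
    obtain ⟨i, -, hi, hiv⟩ := hv 0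
    refine ⟨i, fun M => ?_⟩
    obtain ⟨j, hjM, hj, hjv⟩ := hv (S i - M - 1)
    have hij : i < j := by
      by_contra hle
      rcases Nat.lt_or_eq_of_le (not_lt.1 hle) with h | rfl
      · have := hi j h
        omega
      · omega
    refine ⟨j, (S i - S j).toNat, hij, by omega, hjv.trans hiv.symm, ?_⟩
    -- At a strict record `j`, the cone at `w i ξ` that starts `S i - S j` levels below `N` stays at
    -- level at least `N` and arrives at level `N` exactly at time `j`; its inverse contracts.
    have := (MapsCone.of_path (o := o) hw hs' hij.le (a := N + (S i - S j).toNat) (b := N)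
      (fun l _ hl => by have := hj l hl; push_cast; omega) (by push_cast; omega)).inv
    simpa using this

/-! ### Higman-Thompson elements are tame -/

/-- Apply recurrence to the forward orbit of `ξ`. A fixed returning cone makes `ξ` locally periodic,
and a cone contracted forwards pulls back to one around `ξ`. When the return is backwards, unbounded
contraction forces the centre to be the orbit point itself. -/
theorem IsHigmanThompson.isTame {g : T.Boundary ≃ₜ T.Boundary} (hg : IsHigmanThompson o g) :
    IsTame g := by
  intro ξ
  obtain ⟨N, hN⟩ := hg.exists_level
  have hdiv : ∀ i j, i ≤ j → g ^ i * (g ^ j)⁻¹ = (g ^ (j - i))⁻¹ := fun i j hij => by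
    rw [pow_sub _ hij, mul_inv_rev, inv_inv]
  have hback : ∀ i n, 0 < n → (∀ η ∈ T.ball ((g ^ i) ξ N), (g ^ n) η = η) →
      ∃ n : ℕ, 0 < n ∧ ∀ᶠ y in 𝓝 ξ, (g ^ n) y = y := by
    intro i n hn h
    refine ⟨n, hn, ?_⟩
    filter_upwards [(g ^ i).continuous.continuousAt (ball_mem_nhds ((g ^ i) ξ) N)] with y hy
    refine (g ^ i).injective ?_
    rw [← Homeomorph.mul_apply, ← pow_add, add_comm, pow_add]
    exact h _ hy
  have hconj : ∀ i {f : T.Boundary ≃ₜ T.Boundary} {B a}, Commute g f → Attracts f B a →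
      Attracts f (⇑(g ^ i)⁻¹ '' B) ((g ^ i)⁻¹ a) := by
    intro i f B a hcomm h
    have := h.conj (g ^ i)⁻¹
    rwa [((hcomm.pow_left i).inv_left).eq, mul_inv_cancel_right] at this
  rcases exists_returning_cone (w := fun i => g ^ i) (fun i => pow_succ' g i) ξ
    (fun _ => hN N le_rfl) with ⟨i, j, t, hij, hv, hc⟩ | ⟨i, hi⟩
  · simp only [← pow_sub g hij.le] at hc
    have hfix : (g ^ (j - i)) ((g ^ i) ξ) = (g ^ j) ξ := by
      rw [← Homeomorph.mul_apply, ← pow_add, Nat.sub_add_cancel hij.le]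
    rcases hc.fixed_or_attracts (by rw [hfix]; exact hv) with h | ⟨a, h⟩
    · exact Or.inl (hback i _ (by omega) h)
    · exact Or.inr (Or.inl ⟨j - i, by omega, _, _, hconj i ((Commute.refl g).pow_right _) h,
        (g ^ i) ξ, ⟨N, rfl⟩, by simp⟩)
  · have hfix : ∀ j, i ≤ j → (g ^ (j - i))⁻¹ ((g ^ j) ξ) = (g ^ i) ξ := by
      intro j hij
      rw [← hdiv i j hij]
      simp
    obtain ⟨j, t, hij, ht, hv, hc⟩ := hi 0
    simp only [hdiv i j hij.le] at hc hv
    rcases hc.fixed_or_attracts (by rw [hfix j hij.le]; exact hv.symm) with h | ⟨a, h⟩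
    · refine Or.inl (hback i (j - i) (by omega) fun η hη => ?_)
      rw [← hv] at hη
      exact inv_mem_iff.1 (mem_homeoStabilizer.2 (h η hη))
    -- All these backward returns commute, so each fixes `a`, the only fixed point in the ball. The
    -- return with shift `t' > M` maps the ball onto the cone of level `N + t'` around `g ^ i ξ`, so
    -- `a` and `g ^ i ξ` agree up to level `M`.
    · have ha : a = (g ^ i) ξ := by
        refine Boundary.ext (funext fun M => ?_)
        obtain ⟨j', t', hij', ht', hv', hc'⟩ := hi M
        simp only [hdiv i j' hij'.le] at hc' hv'
        have haN : a N = (g ^ j') ξ N := by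
          rw [hv', ← hv]
          exact mem_ball_vertex.1 h.mem
        have h1 := hc'.apply_eq_iff.1 haN
        rw [hfix j' hij'.le] at h1
        have h2 : (g ^ (j' - i))⁻¹ a = a := by
          refine h.eq_of_pow_apply_eq (n := 1) (mem_ball_vertex.2 ?_) one_pos ?_
          · rw [hv]
            exact Boundary.eq_of_le h1 N (by omega)
          · have hcomm : Commute (g ^ (j - i))⁻¹ (g ^ (j' - i))⁻¹ :=
              (((Commute.refl g).pow_left _).pow_right _).inv_inv
            rw [pow_one, ← Homeomorph.mul_apply, hcomm.eq, Homeomorph.mul_apply, h.fixed]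
        rw [h2] at h1
        exact Boundary.eq_of_le h1 M (by omega)
      have := hconj i ((Commute.refl g).pow_right _).inv_right h
      rw [ha] at this
      exact Or.inr (Or.inr ⟨j - i, by omega, _, by simpa using this⟩)

/-- If no orbit of a finitely generated group is finite, the hyperbolic sets of its elements cover
the boundary. -/
theorem exists_mem_hyperbolicSet {H : Subgroup (T.Boundary ≃ₜ T.Boundary)}
    (hH : H ≤ T.higmanThompson o) (hfg : H.FG) (hfin : ¬ HasFiniteOrbit H) (ξ : T.Boundary) :
    ∃ g ∈ H, ξ ∈ hyperbolicSet g := by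
  obtain ⟨S, hSH, hS⟩ := (Subgroup.fg_iff H).1 hfg
  have hSsub : S ∪ S⁻¹ ⊆ H := by
    rintro s (hs | hs)
    · exact hSH ▸ Subgroup.subset_closure hs
    · exact inv_mem_iff.1 (hSH ▸ Subgroup.subset_closure hs : s⁻¹ ∈ H)
  have hSfin : (S ∪ S⁻¹).Finite := hS.union hS.inv
  have hinf : {y | ∃ k, y ∈ pathEnds (S ∪ S⁻¹) k ξ}.Infinite := fun hf => hfin ⟨ξ, hf.subset <| by
    rintro _ ⟨h, hh, rfl⟩
    exact exists_mem_pathEnds_of_mem_closure (hSH ▸ hh) ξ⟩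
  obtain ⟨s, w, hsS, hw0, hw, hinj⟩ := exists_injective_ray hSfin hinf
  have hwH : ∀ i, w i ∈ H := by
    intro i
    induction i with
    | zero => rw [hw0]; exact H.one_mem
    | succ i ih => rw [hw]; exact H.mul_mem (hSsub (hsS i)) ih
  obtain ⟨N, hN⟩ : ∃ N, ∀ i η, ∃ m, MapsCone o (s i) N m η := by
    have hlev : ∀ g : T.Boundary ≃ₜ T.Boundary, ∃ N, g ∈ S ∪ S⁻¹ →
        ∀ n ≥ N, ∀ ξ, ∃ m, MapsCone o g n m ξ := by
      intro g
      by_cases hg : g ∈ S ∪ S⁻¹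
      · obtain ⟨N, hN⟩ := IsHigmanThompson.exists_level (o := o) (g := g) (hH (hSsub hg))
        exact ⟨N, fun _ => hN⟩
      · exact ⟨0, fun h => absurd h hg⟩
    choose N hN using hlev
    obtain ⟨M, hM⟩ := (hSfin.image N).bddAbove
    exact ⟨M, fun i => hN (s i) (hsS i) M (hM ⟨_, hsS i, rfl⟩)⟩
  -- The return map sends `w i ξ` to the different point `w j ξ`, so it is not the identity on the
  -- cone and must contract it. Conjugating by `(w i)⁻¹` carries the contracted set back to `ξ`.
  have key : ∀ i j t, i ≠ j → w j ξ N = w i ξ N →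
      MapsCone o (w j * (w i)⁻¹) N (N + t) (w i ξ) → ∃ g ∈ H, ξ ∈ hyperbolicSet g := by
    intro i j t hij hv hc
    have hfix : (w j * (w i)⁻¹) (w i ξ) = w j ξ := by simp
    rcases hc.fixed_or_attracts (by rw [hfix]; exact hv) with h | ⟨a, h⟩
    · have := h (w i ξ) (mem_ball_vertex.2 rfl)
      rw [hfix] at this
      exact absurd (hinj this).symm hij
    · have hconj := h.conj (w i)⁻¹
      rw [← zpow_one ((w i)⁻¹ * (w j * (w i)⁻¹) * (w i)⁻¹⁻¹)] at hconj
      have hmem : ξ ∈ ⇑(w i)⁻¹ '' T.ball (w i ξ N) :=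
        ⟨w i ξ, mem_ball_vertex.2 rfl, (w i).symm_apply_apply ξ⟩
      exact ⟨_, H.mul_mem (H.mul_mem (H.inv_mem (hwH i)) (H.mul_mem (hwH j) (H.inv_mem (hwH i))))
        (H.inv_mem (H.inv_mem (hwH i))), 1, _, _, hconj, hmem⟩
  rcases exists_returning_cone hw ξ hN with ⟨i, j, t, hij, hv, hc⟩ | ⟨i, hi⟩
  · exact key i j t hij.ne hv hc
  · obtain ⟨j, t, hij, -, hv, hc⟩ := hi 0
    exact key j i t hij.ne' hv.symm hc

end LFRootedTree

theorem theoremB {V : Type*} (T : LFRootedTree V) (o : T.ChildOrders)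
    (H : Subgroup (T.Boundary ≃ₜ T.Boundary)) (hH : H ≤ T.higmanThompson o) (hfg : H.FG) :
    HasFiniteOrbit H ∨ HasPingPongPair H := by
  by_cases hfin : HasFiniteOrbit H
  · exact Or.inl hfin
  · exact Or.inr (hasPingPongPair_of_isTame
      (fun g hg => LFRootedTree.IsHigmanThompson.isTame (o := o) (hH hg))
      (LFRootedTree.exists_mem_hyperbolicSet hH hfg hfin) hfin)
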